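/- **Setting.** Let $0<\varphi\le\frac{\pi}{2}$, $c=\cos\varphi$, $s=\sin\varphi$, and consider the circular arc $\mathbf c(\alpha)=(\cos\alpha,\sin\alpha)^T$, $\alpha\in[-\varphi,\varphi]$. A *quartic $G^1$ approximant* of the arc is a polynomial curve $\mathbf p:[-1,1]\to\mathbb R^2$ of degree at most $4$, symmetric across the abscissa (i.e. $\mathbf p(-t)$ is the reflection of $\mathbf p(t)$), with $\mathbf p(\pm1)=\mathbf c(\pm\varphi)$ and with $\mathbf p'(\pm1)$ a positive multiple of $\mathbf c'(\pm\varphi)$. Put $\psi(t)=\|\mathbf p(t)\|_2^2-1$. The approximant is *outer* if $\psi\ge 0$ on $[-1,1]$, and an outer quartic $G^1$ approximant is *optimal* if it minimizes $\max_{t\in[-1,1]}|\psi(t)|$ among all outer quartic $G^1$ approximants. For real $u,v$ let $\mathbf p_{uv}$ be the quartic Bézier curve over $[-1,1]$ with control points $$\mathbf b_0=(c,-s)^T,\quad \mathbf b_1=\mathbf b_0+\xi(s,c)^T,\quad \mathbf b_2=(\eta,0)^T,\quad \mathbf b_3=\mathbf b_4+\xi(s,-c)^T,\quad \mathbf b_4=(c,s)^T,$$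 where $\xi=\frac{v-u}{8s}$ and $\eta=\frac{u+v}{6}$, and let $\psi_{uv}(t,u,v)=\|\mathbf p_{uv}(t)\|_2^2-1$, with $\psi_{uv}'$ its derivative in $t$. Let $\mathcal D=I\times[8-5c,\infty)$, where $$I=(3c,\tilde u)\ \text{ if } c>0,\qquad I=(3c,\tilde u]\ \text{ if } c=0,\qquad \tilde u=kc^2-(2k-3)c+k,\quad k=2\sqrt{\tfrac{2\sqrt2-1}{7}}.$$ Let $p_1(u)=\frac{1}{1-c^2}\left(\alpha_4u^4+\alpha_3u^3+\alpha_2u^2+\alpha_1u+\alpha_0\right)$ with $$\begin{aligned} \alpha_4&=c^2(c^2+1),\\ \alpha_3&=-8(3+\sqrt2)c^5+4(4+5\sqrt2)c^3+4(4+3\sqrt2)c,\\ \alpha_2&=2(125+68\sqrt2)c^6-2(229+182\sqrt2)c^4+4(140+97\sqrt2)c^2-4(65+46\sqrt2),\\ \alpha_1&=-88(14+9\sqrt2)c^7+12(116+89\sqrt2)c^5-84(16+11\sqrt2)c^3+4(50+36\sqrt2)c,\\ \alpha_0&=5(457+312\sqrt2)c^8-(1655+1236\sqrt2)c^6+12(16+9\sqrt2)c^4+4(163+114\sqrt2)c^2+272+192\sqrt2,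 \end{aligned}$$ and let $$\begin{aligned} \beta_1&=-2\left(4c^8+4(4+\sqrt2)c^6-(1+6\sqrt2)c^4+2c^2+3+2\sqrt2\right),\\ \beta_0(u)&=36(3-2\sqrt2)c^9+16(3\sqrt2-5)c^8u+\left(329-198\sqrt2+(12-8\sqrt2)u^2\right)c^7+(142\sqrt2-253)c^6u\\ &\quad+\left(169-198\sqrt2+(55-34\sqrt2)u^2\right)c^5+\left(174\sqrt2-51+(2\sqrt2-3)u^2\right)c^4u\\ &\quad+\left(4(43+9\sqrt2)-5(6\sqrt2-7)u^2\right)c^3-\left(16(7+3\sqrt2)u+(3-2\sqrt2)u^3\right)c^2\\ &\quad+2(23+16\sqrt2)u-4c\left(10+9\sqrt2+\sqrt2u^2\right). \end{aligned}$$ **Theorem.** The system $$\psi_{uv}(\sqrt2-1,u,v)=0,\qquad \psi_{uv}'(\sqrt2-1,u,v)=0$$ has exactly one solution $(u^\land,v^\land)$ in $\mathcal D$. It is also its only solution in $(3c,\tilde u]\times[8-5c,\infty)$. The number $u^\land$ is the unique zero of $p_1$ in $I$ (and in $(3c,\tilde u]$), $\beta_1\ne0$, and $v^\land=-\beta_0(u^\land)/\beta_1$.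 The curve $\mathbf p_{u^\land v^\land}$ is an optimal outer quartic $G^1$ approximant of the arc, and it is the only one. -/

import Mathlib

open Real Set

noncomputable section

namespace CircularArc

/-- The Euclidean plane. -/
abbrev Plane := EuclideanSpace ℝ (Fin 2)

/-- The standard parameterization of the unit circle; the circular arc with inner angle `2 φ` is
its restriction to `[-φ, φ]`. -/
def arc (α : ℝ) : Plane := !₂[cos α, sin α]

/-- The reflection of the plane across the abscissa. -/
def reflect (x : Plane) : Plane := !₂[x 0, -x 1]

/-- The `i`-th Bernstein basis polynomial of degree `n`, reparameterized to `[-1, 1]`. -/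
def bern (n i : ℕ) (t : ℝ) : ℝ :=
  (n.choose i : ℝ) * ((1 + t) / 2) ^ i * ((1 - t) / 2) ^ (n - i)

/-- The polynomial curve of degree at most `n` with control points `b 0, …, b n`
(every polynomial curve of degree at most `n` is of this form). -/
def bezier {n : ℕ} (b : Fin (n + 1) → Plane) (t : ℝ) : Plane :=
  ∑ i : Fin (n + 1), bern n i t • b i

/-- `p` is a quartic `G¹` approximant of the arc `arc : [-φ, φ] → ℝ²`: a polynomial curve of degree
at most four, symmetric across the abscissa, that interpolates the boundary points of the arc and
the (oriented) tangent directions there. -/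
structure IsQuarticG1 (φ : ℝ) (p : ℝ → Plane) : Prop where
  exists_bezier : ∃ b : Fin 5 → Plane, p = bezier b
  symm : ∀ t, p (-t) = reflect (p t)
  left : p (-1) = arc (-φ)
  right : p 1 = arc φ
  tangent_left : ∃ r : ℝ, 0 < r ∧ deriv p (-1) = r • deriv arc (-φ)
  tangent_right : ∃ r : ℝ, 0 < r ∧ deriv p 1 = r • deriv arc φ

/-- The simplified radial error `ψ(t) = ‖p(t)‖² - 1`. -/
def psi (p : ℝ → Plane) (t : ℝ) : ℝ := ‖p t‖ ^ 2 - 1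

/-- The curve stays out of the open unit disc: `ψ ≥ 0` on `[-1, 1]`. -/
def IsOuter (p : ℝ → Plane) : Prop := ∀ t ∈ Icc (-1 : ℝ) 1, 0 ≤ psi p t

/-- `max_{t ∈ [-1, 1]} |ψ(t)|` (attained for polynomial curves). -/
def maxError (p : ℝ → Plane) : ℝ := sSup ((fun t => |psi p t|) '' Icc (-1 : ℝ) 1)

/-- `p` is an optimal outer quartic `G¹` approximant: it is one, and no other one has a
smaller maximal error. -/
def IsOptimalOuter (φ : ℝ) (p : ℝ → Plane) : Prop :=
  IsQuarticG1 φ p ∧ IsOuter p ∧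
    ∀ q : ℝ → Plane, IsQuarticG1 φ q → IsOuter q → maxError p ≤ maxError q

/-- The control points of the quartic `G¹` approximant with parameters `ξ`, `η`. -/
def controlPoints (φ ξ η : ℝ) : Fin 5 → Plane :=
  ![!₂[cos φ, -sin φ],
    !₂[cos φ, -sin φ] + ξ • !₂[sin φ, cos φ],
    !₂[η, 0],
    !₂[cos φ, sin φ] + ξ • !₂[sin φ, -cos φ],
    !₂[cos φ, sin φ]]

/-- The curve with parameters `u = 3 η - 4 ξ sin φ` and `v = 3 η + 4 ξ sin φ`. -/
def curveUV (φ u v : ℝ) : ℝ → Plane :=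
  bezier (controlPoints φ ((v - u) / (8 * sin φ)) ((u + v) / 6))

/-- The error function `ψ_{uv}(t, u, v)`. -/
def psiUV (φ t u v : ℝ) : ℝ := psi (curveUV φ u v) t

/-- The algebraic system `ψ_{uv}(√2 - 1, u, v) = 0`, `ψ_{uv}'(√2 - 1, u, v) = 0`, where the
derivative is taken with respect to `t`. -/
def System (φ u v : ℝ) : Prop :=
  psiUV φ (√2 - 1) u v = 0 ∧ deriv (fun t => psiUV φ t u v) (√2 - 1) = 0

/-- The constant `k` in the definition of `ũ`. -/
def kConst : ℝ := 2 * √((2 * √2 - 1) / 7)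

/-- The right end point `ũ` of the interval for `u`. -/
def uTilde (c : ℝ) : ℝ := kConst * c ^ 2 - (2 * kConst - 3) * c + kConst

/-! The coefficients of `(1 - c²) p₁`, and then of `(c² - 1) p₂ = β₁ v + β₀(u)`. -/

def alpha4 (c : ℝ) : ℝ := c ^ 2 * (c ^ 2 + 1)

def alpha3 (c : ℝ) : ℝ :=
  -8 * (3 + √2) * c ^ 5 + 4 * (4 + 5 * √2) * c ^ 3 + 4 * (4 + 3 * √2) * c

def alpha2 (c : ℝ) : ℝ :=
  2 * (125 + 68 * √2) * c ^ 6 - 2 * (229 + 182 * √2) * c ^ 4 + 4 * (140 + 97 * √2) * c ^ 2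
    - 4 * (65 + 46 * √2)

def alpha1 (c : ℝ) : ℝ :=
  -88 * (14 + 9 * √2) * c ^ 7 + 12 * (116 + 89 * √2) * c ^ 5 - 84 * (16 + 11 * √2) * c ^ 3
    + 4 * (50 + 36 * √2) * c

def alpha0 (c : ℝ) : ℝ :=
  5 * (457 + 312 * √2) * c ^ 8 - (1655 + 1236 * √2) * c ^ 6 + 12 * (16 + 9 * √2) * c ^ 4
    + 4 * (163 + 114 * √2) * c ^ 2 + 272 + 192 * √2

/-- The polynomial `p₁` (quartic in `u`). -/
def p1 (c u : ℝ) : ℝ :=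
  1 / (1 - c ^ 2) *
    (alpha4 c * u ^ 4 + alpha3 c * u ^ 3 + alpha2 c * u ^ 2 + alpha1 c * u + alpha0 c)

def beta1 (c : ℝ) : ℝ :=
  -2 * (4 * c ^ 8 + 4 * (4 + √2) * c ^ 6 - (1 + 6 * √2) * c ^ 4 + 2 * c ^ 2 + 3 + 2 * √2)

def beta0 (c u : ℝ) : ℝ :=
  36 * (3 - 2 * √2) * c ^ 9 + 16 * (3 * √2 - 5) * c ^ 8 * u
    + (329 - 198 * √2 + (12 - 8 * √2) * u ^ 2) * c ^ 7
    + (142 * √2 - 253) * c ^ 6 * u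
    + (169 - 198 * √2 + (55 - 34 * √2) * u ^ 2) * c ^ 5
    + (174 * √2 - 51 + (2 * √2 - 3) * u ^ 2) * c ^ 4 * u
    + (4 * (43 + 9 * √2) - 5 * (6 * √2 - 7) * u ^ 2) * c ^ 3
    - (16 * (7 + 3 * √2) * u + (3 - 2 * √2) * u ^ 3) * c ^ 2
    + 2 * (23 + 16 * √2) * u
    - 4 * c * (10 + 9 * √2 + √2 * u ^ 2)

end CircularArc

end

open Real Set

noncomputable section

namespace CircularArc

/-! ### The radial error as a quadratic polynomial -/

/-! With `b = (u - 3c) / 8` and `w = 1 - t²` the radial error is `w²` times a quadratic `radQuad` in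
`w` with leading coefficient `b²`. The system at `t = √2 - 1`, that is at `w = ω = 2√2 - 2`, says
that this quadratic has a double zero there, so `ψ = (b w (w - ω))²`. The number `ω` makes `|w (w -
ω)|` reach its maximum `3 - 2√2` on `[0, 1]` both at `w = ω / 2` and at `w = 1`, so `ψ` alternates
between its maximum and `0` at `ω / 2 < ω < 1`.

Existence: eliminating `ξ` (`isTouching_iff`) leaves one quartic in `b`, which is `p₁` up to a
nonzero factor (`p1_eq`); it changes sign, or vanishes at the right end, on the interval given by
`ũ`.

Optimality and uniqueness both come from `eq_of_radQuad_le`. If an outer curve has error at most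
that of the touching one, the difference of the two quadratics has signs `≤, ≥, ≤` at the three
points. This restricts its coefficients, and a Jacobian-type inequality at the touching parameters
(`isTouching_margin`) forces both parameters to agree. Two touching curves satisfy the same sign
conditions, so the quartic has only one root in the interval. -/

/-- The quadratic factor of the radial error: `ψ(t) = w² radQuad w` with `w = 1 - t²`. -/
def radQuad (c s ξ b w : ℝ) : ℝ :=
  (ξ ^ 2 + ξ * c * s + 2 * b * c - 3 * s ^ 2 / 4) + (2 * ξ * b * s - (s / 2 - ξ * c) ^ 2) * w
    + b ^ 2 * w ^ 2

/-- The parameters for which `radQuad` has a double zero at `2 √2 - 2`. -/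
def IsTouching (c s ξ b : ℝ) : Prop :=
  ξ ^ 2 + ξ * c * s + 2 * b * c - 3 * s ^ 2 / 4 = b ^ 2 * (2 * √2 - 2) ^ 2 ∧
    2 * ξ * b * s - (s / 2 - ξ * c) ^ 2 = -2 * b ^ 2 * (2 * √2 - 2)

lemma sq_sqrt_two : √2 ^ 2 = (2 : ℝ) := Real.sq_sqrt (by norm_num)

lemma sqrt_two_gt : (1.41421 : ℝ) < √2 := Real.lt_sqrt_of_sq_lt (by norm_num)

lemma sqrt_two_lt : √2 < (1.41422 : ℝ) := by
  rw [Real.sqrt_lt' (by norm_num)]; norm_num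

lemma IsTouching.radQuad_eq {c s ξ b : ℝ} (h : IsTouching c s ξ b) (w : ℝ) :
    radQuad c s ξ b w = b ^ 2 * (w - (2 * √2 - 2)) ^ 2 := by
  unfold radQuad
  rw [h.1, h.2]
  ring

/-- A double zero is a zero of the value and of the derivative; this form matches the two equations
of the system. -/
lemma isTouching_iff_radQuad {c s ξ b : ℝ} : IsTouching c s ξ b ↔
    radQuad c s ξ b (2 * √2 - 2) = 0 ∧
      2 * ξ * b * s - (s / 2 - ξ * c) ^ 2 + 2 * b ^ 2 * (2 * √2 - 2) = 0 := by
  unfold IsTouching radQuad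
  constructor
  · rintro ⟨h0, h1⟩
    exact ⟨by linear_combination h0 + (2 * √2 - 2) * h1, by linear_combination h1⟩
  · rintro ⟨h0, h1⟩
    exact ⟨by linear_combination h0 - (2 * √2 - 2) * h1, by linear_combination h1⟩

/-- The denominator of the rational expression for `ξ`. -/
def touchDen (c b : ℝ) : ℝ := c + c ^ 3 + 2 * b

/-- The numerator of the rational expression for `ξ`. -/
def touchNum (c b : ℝ) : ℝ :=
  (1 - c ^ 2) * (1 + 3 * c ^ 2) / 4 - 2 * b * c ^ 3
    - b ^ 2 * (2 * √2 - 2) * (2 - c ^ 2 * (2 * √2 - 2))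

/-- The result of the elimination of `ξ` from `IsTouching`. -/
def touchPoly (c b : ℝ) : ℝ :=
  (1 - c ^ 2) ^ 4 / 16 - c / 2 * (1 - c ^ 2) ^ 2 * (5 + c ^ 2) * b
    + (-1 + 16 * c ^ 2 - c ^ 4 - 10 * c ^ 6
      + (-2 - 4 * c ^ 2 - 2 * c ^ 4 + 8 * c ^ 6) * √2) * b ^ 2
    + (-32 * c - 8 * c ^ 3 - 24 * c ^ 5 + (24 * c + 8 * c ^ 3 + 16 * c ^ 5) * √2) * b ^ 3
    + (272 - 192 * √2) * (c ^ 2 + c ^ 4) * b ^ 4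

lemma touchPoly_eq (c b : ℝ) :
    touchPoly c b = touchNum c b ^ 2 + c * (1 - c ^ 2) * touchNum c b * touchDen c b
      + (1 - c ^ 2) * (2 * b * c - 3 * (1 - c ^ 2) / 4 - b ^ 2 * (2 * √2 - 2) ^ 2)
        * touchDen c b ^ 2 := by
  unfold touchPoly touchNum touchDen
  linear_combination (16 * c * b ^ 3 + 2 * c ^ 2 * b ^ 2 - 112 * c ^ 2 * b ^ 4
    + 32 * c ^ 2 * b ^ 4 * √2 - 8 * c ^ 3 * b ^ 3 - 4 * c ^ 4 * b ^ 2 - 128 * c ^ 4 * b ^ 4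
    + 64 * c ^ 4 * b ^ 4 * √2 - 16 * c ^ 4 * b ^ 4 * √2 ^ 2 + 8 * c ^ 5 * b ^ 3
    + 2 * c ^ 6 * b ^ 2) * sq_sqrt_two

lemma isTouching_iff {c s ξ b : ℝ} (hs : 0 < s) (hcs : s ^ 2 + c ^ 2 = 1) (hc : 0 ≤ c)
    (hb : 0 < b) :
    IsTouching c s ξ b ↔ ξ = touchNum c b / (s * touchDen c b) ∧ touchPoly c b = 0 := by
  have hD : 0 < touchDen c b := by unfold touchDen; positivity
  have hs2 : s ^ 2 = 1 - c ^ 2 := by linarith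
  -- Adding `c²` times the first equation to the second cancels `ξ²`, so `ξ` is a rational function
  -- of `b`.
  have lin : ∀ ω : ℝ, c ^ 2 * (ξ ^ 2 + ξ * c * s + 2 * b * c - 3 * s ^ 2 / 4 - b ^ 2 * ω ^ 2)
      + (2 * ξ * b * s - (s / 2 - ξ * c) ^ 2 + 2 * b ^ 2 * ω)
      = ξ * s * (c + c ^ 3 + 2 * b) - (s ^ 2 * (1 + 3 * c ^ 2) / 4 - 2 * b * c ^ 3
        - b ^ 2 * ω * (2 - c ^ 2 * ω)) := by intro ω; ring
  have lin' := lin (2 * √2 - 2)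
  rw [hs2] at lin'
  change _ = ξ * s * touchDen c b - touchNum c b at lin'
  have key : (ξ * s * touchDen c b - touchNum c b = 0) → touchPoly c b
      = s ^ 2 * touchDen c b ^ 2 * (ξ ^ 2 + ξ * c * s + 2 * b * c - 3 * s ^ 2 / 4
        - b ^ 2 * (2 * √2 - 2) ^ 2) := by
    intro h
    have h' : touchNum c b = ξ * s * touchDen c b := by linarith
    rw [touchPoly_eq, h', ← hs2]
    ring
  have hξ : ξ = touchNum c b / (s * touchDen c b) ↔ ξ * s * touchDen c b - touchNum c b = 0 := by
    rw [eq_div_iff (by positivity), sub_eq_zero, mul_assoc]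
  rw [hξ]
  unfold IsTouching
  constructor
  · rintro ⟨h0, h1⟩
    have hz : ξ * s * touchDen c b - touchNum c b = 0 := by
      rw [← lin', ← hs2]; linear_combination c ^ 2 * h0 + h1
    refine ⟨hz, ?_⟩
    rw [key hz, h0]; ring
  · rintro ⟨hz, hP⟩
    rw [key hz] at hP
    have h0 : ξ ^ 2 + ξ * c * s + 2 * b * c - 3 * s ^ 2 / 4 - b ^ 2 * (2 * √2 - 2) ^ 2 = 0 := by
      rcases mul_eq_zero.1 hP with h | h
      · exact absurd h (by positivity)
      · exact h
    rw [← hs2] at lin'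
    exact ⟨by linarith, by linear_combination lin' - c ^ 2 * h0 + hz⟩

/-! ### The polynomials of the statement -/

lemma p1_eq (c b : ℝ) :
    p1 c (3 * c + 8 * b) = 1 / (1 - c ^ 2) * (16 * (272 + 192 * √2) * touchPoly c b) := by
  unfold p1 alpha4 alpha3 alpha2 alpha1 alpha0 touchPoly
  congr 1
  linear_combination (6144 * b ^ 2 - 73728 * c * b ^ 3 + 12288 * c ^ 2 * b ^ 2
    + 589824 * c ^ 2 * b ^ 4 - 24576 * c ^ 3 * b ^ 3 + 6144 * c ^ 4 * b ^ 2
    + 589824 * c ^ 4 * b ^ 4 - 49152 * c ^ 5 * b ^ 3 - 24576 * c ^ 6 * b ^ 2) * sq_sqrt_two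

/-- Since `v = u + 8 ξ s` and `ξ s touchDen = touchNum`, the left side is `touchDen * (β₁ v +
β₀(u))`; it vanishes at every root of `touchPoly`, which gives the formula for `v`. -/
lemma beta_eq (c b : ℝ) :
    beta1 c * ((3 * c + 8 * b) * touchDen c b + 8 * touchNum c b)
      + beta0 c (3 * c + 8 * b) * touchDen c b = -(192 + 128 * √2) * touchPoly c b := by
  unfold beta1 beta0 touchPoly touchNum touchDen
  linear_combination (-128 * b ^ 2 + 3072 * c * b ^ 3 - 448 * c ^ 2 * b ^ 2
    - 128 * c ^ 2 * b ^ 2 * √2 - 24576 * c ^ 2 * b ^ 4 + 1024 * c ^ 3 * b ^ 3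
    - 768 * c ^ 4 * b ^ 2 - 24576 * c ^ 4 * b ^ 4 + 2048 * c ^ 5 * b ^ 3 + 576 * c ^ 6 * b ^ 2
    + 384 * c ^ 6 * b ^ 2 * √2 - 512 * c ^ 8 * b ^ 2 - 256 * c ^ 8 * b ^ 2 * √2
    - 256 * c ^ 10 * b ^ 2) * sq_sqrt_two

lemma beta1_neg (c : ℝ) : beta1 c < 0 := by
  have h1 := sqrt_two_gt
  have h2 := sqrt_two_lt
  have hx : (0 : ℝ) ≤ c ^ 2 := sq_nonneg c
  have h6 : 21 * c ^ 6 ≤ 4 * (4 + √2) * c ^ 6 := by gcongr; linarith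
  have h4 : (1 + 6 * √2) * c ^ 4 ≤ 10 * c ^ 4 := by gcongr; linarith
  have h8 : 0 ≤ c ^ 8 := by positivity
  have h : 10 * c ^ 4 < 21 * c ^ 6 + 5 := by
    have : c ^ 4 = (c ^ 2) ^ 2 := by ring
    have : c ^ 6 = (c ^ 2) ^ 3 := by ring
    nlinarith [mul_nonneg hx (sq_nonneg (c ^ 2 - 1 / 2)), sq_nonneg (c ^ 2 - 1 / 2)]
  unfold beta1
  nlinarith

lemma kConst_sq : kConst ^ 2 = 4 * (2 * √2 - 1) / 7 := by
  unfold kConst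
  rw [mul_pow, Real.sq_sqrt (by linarith [sqrt_two_gt])]
  ring

lemma kConst_pos : 0 < kConst := by
  unfold kConst
  have : 0 < √((2 * √2 - 1) / 7) := Real.sqrt_pos.2 (by linarith [sqrt_two_gt])
  positivity

lemma kConst_gt : 1.022 < kConst := by
  refine lt_of_pow_lt_pow_left₀ 2 kConst_pos.le ?_
  rw [kConst_sq]
  linarith [sqrt_two_gt]

lemma kConst_lt : kConst < 1.0223 := by
  refine lt_of_pow_lt_pow_left₀ 2 (by norm_num) ?_
  rw [kConst_sq]
  linarith [sqrt_two_lt]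

lemma touchPoly_zero_right (c : ℝ) : touchPoly c 0 = (1 - c ^ 2) ^ 4 / 16 := by
  simp [touchPoly]

/-- The value of `kConst ^ 2` is the one for which `touchPoly 0` vanishes at `kConst / 8`; hence a
factor `c` splits off, and only the sign of the cofactor matters for `0 < c`. -/
lemma touchPoly_kConst (c : ℝ) : touchPoly c (kConst * (1 - c) ^ 2 / 8) = (1 - c) ^ 4 * (c *
    ((1 / 4 - 19 / 112 * kConst - 11 / 112 * (√2 * kConst))
      + (319 / 784 - 51 / 56 * kConst + 19 / 196 * √2 + 11 / 56 * (√2 * kConst)) * c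
      + (-50 / 49 - 3 / 16 * kConst + 44 / 49 * √2 - 1 / 8 * (√2 * kConst)) * c ^ 2
      + (249 / 112 - 3 / 14 * kConst - 11 / 7 * √2 + 3 / 56 * (√2 * kConst)) * c ^ 3
      + (-249 / 98 + 9 / 112 * kConst + 88 / 49 * √2 - 11 / 112 * (√2 * kConst)) * c ^ 4
      + (291 / 112 - 11 / 56 * kConst - 51 / 28 * √2 + 1 / 7 * (√2 * kConst)) * c ^ 5
      + (-249 / 196 + 11 / 112 * kConst + 44 / 49 * √2 - 1 / 14 * (√2 * kConst)) * c ^ 6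
      + (249 / 784 - 11 / 49 * √2) * c ^ 7)) := by
  have hk := kConst_sq
  unfold touchPoly
  generalize kConst = k at hk ⊢
  linear_combination (1 - c) ^ 4 * ((-1 + 16 * c ^ 2 - c ^ 4 - 10 * c ^ 6
      + (-2 - 4 * c ^ 2 - 2 * c ^ 4 + 8 * c ^ 6) * √2) / 64
    + (-32 * c - 8 * c ^ 3 - 24 * c ^ 5 + (24 * c + 8 * c ^ 3 + 16 * c ^ 5) * √2)
      * k * (1 - c) ^ 2 / 512
    + (272 - 192 * √2) * (c ^ 2 + c ^ 4) * (1 - c) ^ 4 / 4096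
      * (k ^ 2 + 4 * (2 * √2 - 1) / 7)) * hk
    + (1 - c) ^ 4 * (-1 / 28 + 3 / 56 * c * k + 15 / 196 * c ^ 2 - 3 / 28 * c ^ 2 * k
      - 3 / 49 * c ^ 2 * √2 - 29 / 49 * c ^ 3 + 1 / 14 * c ^ 3 * k + 12 / 49 * c ^ 3 * √2 + c ^ 4
      - 1 / 28 * c ^ 4 * k - 3 / 7 * c ^ 4 * √2 - 58 / 49 * c ^ 5 + 3 / 56 * c ^ 5 * k
      + 24 / 49 * c ^ 5 * √2 + 33 / 28 * c ^ 6 - 1 / 14 * c ^ 6 * k - 3 / 7 * c ^ 6 * √2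
      - 29 / 49 * c ^ 7 + 1 / 28 * c ^ 7 * k + 12 / 49 * c ^ 7 * √2 + 29 / 196 * c ^ 8
      - 3 / 49 * c ^ 8 * √2) * sq_sqrt_two

lemma touchPoly_kConst_neg {c : ℝ} (hc : 0 < c) (hc1 : c < 1) :
    touchPoly c (kConst * (1 - c) ^ 2 / 8) < 0 := by
  rw [touchPoly_kConst]
  have h1 := sqrt_two_gt
  have h2 := sqrt_two_lt
  have h3 := kConst_gt
  have h4 := kConst_lt
  have h5 : 1.4453 < √2 * kConst := by nlinarith
  have h6 : √2 * kConst < 1.4458 := by nlinarith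
  generalize √2 * kConst = m at h5 h6 ⊢
  refine mul_neg_of_pos_of_neg (pow_pos (by linarith) 4) (mul_neg_of_pos_of_neg hc ?_)
  have nonpos : ∀ (x : ℝ) (n : ℕ), x ≤ 0 → x * c ^ n ≤ 0 := fun x n hx =>
    mul_nonpos_of_nonpos_of_nonneg hx (by positivity)
  -- Only the coefficients of `c ^ 5` and `c ^ 7` fail to be nonpositive. Together they contribute
  -- at most `0.06`, while the constant term is below `-0.065`.
  have small : ∀ (x : ℝ) (n : ℕ), x ≤ 0.03 → x * c ^ n ≤ 0.03 := fun x n hx => by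
    have h0 : 0 ≤ c ^ n := by positivity
    have h1 : c ^ n ≤ 1 := pow_le_one₀ hc.le hc1.le
    nlinarith
  have e1 := nonpos (319 / 784 - 51 / 56 * kConst + 19 / 196 * √2 + 11 / 56 * m) 1 (by linarith)
  have e2 := nonpos (-50 / 49 - 3 / 16 * kConst + 44 / 49 * √2 - 1 / 8 * m) 2 (by linarith)
  have e3 := nonpos (249 / 112 - 3 / 14 * kConst - 11 / 7 * √2 + 3 / 56 * m) 3 (by linarith)
  have e4 := nonpos (-249 / 98 + 9 / 112 * kConst + 88 / 49 * √2 - 11 / 112 * m) 4 (by linarith)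
  have e5 := small (291 / 112 - 11 / 56 * kConst - 51 / 28 * √2 + 1 / 7 * m) 5 (by linarith)
  have e6 := nonpos (-249 / 196 + 11 / 112 * kConst + 44 / 49 * √2 - 1 / 14 * m) 6 (by linarith)
  have e7 := small (249 / 784 - 11 / 49 * √2) 7 (by linarith)
  linarith

lemma exists_touchPoly_eq_zero {c : ℝ} (hc : 0 ≤ c) (hc1 : c < 1) :
    ∃ b, 0 < b ∧ b ≤ kConst * (1 - c) ^ 2 / 8 ∧ (0 < c → b < kConst * (1 - c) ^ 2 / 8) ∧
      touchPoly c b = 0 := by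
  have h0 : 0 < touchPoly c 0 := by
    rw [touchPoly_zero_right]
    have : 0 < 1 - c ^ 2 := by nlinarith
    positivity
  have hend : touchPoly c (kConst * (1 - c) ^ 2 / 8) ≤ 0 := by
    rcases hc.eq_or_lt with rfl | h
    · rw [touchPoly_kConst]; simp
    · exact (touchPoly_kConst_neg h hc1).le
  have hle : 0 ≤ kConst * (1 - c) ^ 2 / 8 := by
    have := kConst_pos
    positivity
  have hcont : ContinuousOn (touchPoly c) (Icc 0 (kConst * (1 - c) ^ 2 / 8)) := by
    unfold touchPoly
    fun_prop
  obtain ⟨b, hb, hb0⟩ := intermediate_value_Icc' hle hcont ⟨hend, h0.le⟩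
  refine ⟨b, lt_of_le_of_ne hb.1 ?_, hb.2, fun h => lt_of_le_of_ne hb.2 ?_, hb0⟩
  · rintro rfl; linarith
  · rintro rfl; linarith [touchPoly_kConst_neg h hc1]

lemma touchNum_pos {c b : ℝ} (hc : 0 ≤ c) (hc1 : c < 1) (hb : 0 < b)
    (hb2 : b ≤ 0.128 * (1 - c) ^ 2) : 0 < touchNum c b := by
  have h1 := sqrt_two_gt
  have h2 := sqrt_two_lt
  have hb3 : b ≤ 0.128 * (1 - c) := by nlinarith
  have hω : (2 * √2 - 2) * (2 - c ^ 2 * (2 * √2 - 2)) ≤ 2 := by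
    nlinarith [mul_nonneg (sq_nonneg c) (sq_nonneg (2 * √2 - 2))]
  have e1 : 2 * b * c ^ 3 ≤ 2 * (0.128 * (1 - c)) * c ^ 2 := by
    have : c ^ 3 ≤ c ^ 2 := pow_le_pow_of_le_one hc hc1.le (by norm_num)
    have h0 : 0 ≤ c ^ 3 := by positivity
    nlinarith [sq_nonneg c]
  have e2 : b ^ 2 * ((2 * √2 - 2) * (2 - c ^ 2 * (2 * √2 - 2))) ≤ 0.128 * (1 - c) * 0.256 := by
    have : b ^ 2 ≤ 0.128 * (1 - c) * 0.128 := by nlinarith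
    nlinarith [sq_nonneg b]
  have e3 : (1 - c) * (1 + 3 * c ^ 2) ≤ (1 - c ^ 2) * (1 + 3 * c ^ 2) := by
    have : 1 - c ≤ 1 - c ^ 2 := by nlinarith
    gcongr
  unfold touchNum
  nlinarith [mul_nonneg (sub_pos.2 hc1).le (sq_nonneg c)]

/-! ### Comparison with a touching quadratic -/

lemma isTouching_pos {c s ξ b : ℝ} (hs : 0 < s) (hcs : s ^ 2 + c ^ 2 = 1) (hc : 0 ≤ c)
    (hb : 0 < b) (hb2 : b ≤ 0.128 * (1 - c) ^ 2) (h : IsTouching c s ξ b) : 0 < ξ := by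
  rw [((isTouching_iff hs hcs hc hb).1 h).1]
  have hD : 0 < touchDen c b := by unfold touchDen; positivity
  exact div_pos (touchNum_pos hc (by nlinarith) hb hb2) (by positivity)

/-- This is the inequality needed in `isTouching_margin`, with `ξ` replaced by its rational
expression and denominators cleared. The bound `0.128` exceeds `kConst / 8`. -/
lemma touch_margin {c b : ℝ} (hc : 0 ≤ c) (hc1 : c < 1) (hb : 0 < b)
    (hb2 : b ≤ 0.128 * (1 - c) ^ 2) :
    6 * c * (1 - c ^ 2) * b * touchDen c b
      + 2 * c ^ 2 * ((1 - c ^ 2) ^ 2 * c / 4 + (1 - c ^ 2) * b + 2 * b * c ^ 4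
        + c * b ^ 2 * ((2 * √2 - 2) * (2 - c ^ 2 * (2 * √2 - 2))))
      < (1 - c ^ 2) ^ 2 * touchDen c b := by
  have h1 := sqrt_two_gt
  have h2 := sqrt_two_lt
  have hω : (2 * √2 - 2) * (2 - c ^ 2 * (2 * √2 - 2)) ≤ 2 := by
    nlinarith [mul_nonneg (sq_nonneg c) (sq_nonneg (2 * √2 - 2))]
  generalize (2 * √2 - 2) * (2 - c ^ 2 * (2 * √2 - 2)) = m at hω ⊢
  have hb3 : b ≤ 0.128 := by nlinarith
  have hp2 : c ^ 2 ≤ 1 := pow_le_one₀ hc hc1.le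
  have hp4 : c ^ 4 ≤ c := by simpa using pow_le_pow_of_le_one hc hc1.le (show 1 ≤ 4 by norm_num)
  have hp3 : c ^ 3 ≤ c ^ 2 := pow_le_pow_of_le_one hc hc1.le (by norm_num)
  -- the factor of `b * c` in the left-hand side is small
  have hB : 6 * (1 - c ^ 2) * (c + c ^ 3 + 2 * b)
      + 2 * c * ((1 - c ^ 2) + 2 * c ^ 4 + c * b * m) ≤ 7.8 * (1 + c) ^ 2 := by
    have e1 : 6 * (1 - c ^ 2) * (c + c ^ 3 + 2 * b) ≤ 6 * (1 - c ^ 2) * (c + c ^ 3 + 0.256) := by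
      have : 0 ≤ 1 - c ^ 2 := by linarith
      gcongr
      linarith
    have e2 : c * b * m ≤ 0.256 := by
      have : 0 ≤ c * b := by positivity
      nlinarith
    have e3 : 2 * c * ((1 - c ^ 2) + 2 * c ^ 4 + c * b * m)
        ≤ 2 * c * ((1 - c ^ 2) + 2 * c ^ 4 + 0.256) := by gcongr
    have e4 : 2 * c * (2 * c ^ 4) ≤ 2 * c * (2 * c) := by gcongr
    have e5 : 0 ≤ c ^ 5 := by positivity
    have e6 : 0 ≤ c ^ 3 := by positivity
    nlinarith
  have hσ : 0 < (1 - c) ^ 2 := by nlinarith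
  have hbc : b * c * (6 * (1 - c ^ 2) * (c + c ^ 3 + 2 * b)
      + 2 * c * ((1 - c ^ 2) + 2 * c ^ 4 + c * b * m))
      ≤ b * c * (7.8 * (1 + c) ^ 2) := by gcongr
  have hbc2 : b * c * (7.8 * (1 + c) ^ 2) ≤ 0.128 * (1 - c) ^ 2 * c * (7.8 * (1 + c) ^ 2) := by
    gcongr
  have hR : 0.128 * (1 - c) ^ 2 * c * (7.8 * (1 + c) ^ 2)
      < (1 - c ^ 2) ^ 2 * (c + c ^ 3 / 2 + 2 * b) := by
    have : 0 < (1 - c ^ 2) ^ 2 := by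
      have : 0 < 1 - c ^ 2 := by nlinarith
      positivity
    -- The estimate closes because `0.128 * 7.8 < 1`.
    have h3 : 0.128 * c * 7.8 < c + c ^ 3 / 2 + 2 * b := by
      have : 0 ≤ c ^ 3 := by positivity
      linarith
    nlinarith [mul_lt_mul_of_pos_left h3 this]
  unfold touchDen
  linarith

/-- The second inequality says that the constant and linear coefficients of `radQuad`, as functions
of `(ξ, b)`, have a Jacobian of definite sign. The first touching equation removes `ξ²` and reduces
it to `touch_margin`. -/
lemma isTouching_margin {c s ξ b : ℝ} (hs : 0 < s) (hcs : s ^ 2 + c ^ 2 = 1) (hc : 0 ≤ c)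
    (hb : 0 < b) (hb2 : b ≤ 0.128 * (1 - c) ^ 2) (h : IsTouching c s ξ b) :
    0 < s / 2 - ξ * c ∧
      2 * c * s * b + 2 * c ^ 2 * (s / 2 - ξ * c) < s * ξ * (2 * ξ + c * s) := by
  have hc1 : c < 1 := by nlinarith
  have hD : 0 < touchDen c b := by unfold touchDen; positivity
  have hs2 : s ^ 2 = 1 - c ^ 2 := by linarith
  have hξ := ((isTouching_iff hs hcs hc hb).1 h).1
  rw [eq_div_iff (by positivity)] at hξ
  have hm := touch_margin hc hc1 hb hb2
  have hRD : s * (s / 2 - ξ * c) * touchDen c b = (1 - c ^ 2) ^ 2 * c / 4 + (1 - c ^ 2) * b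
      + 2 * b * c ^ 4 + c * b ^ 2 * ((2 * √2 - 2) * (2 - c ^ 2 * (2 * √2 - 2))) := by
    have : s * (s / 2 - ξ * c) * touchDen c b = s ^ 2 / 2 * touchDen c b - c * touchNum c b := by
      rw [← hξ]; ring
    rw [this, hs2]
    unfold touchDen touchNum
    ring
  have hR : 0 < s / 2 - ξ * c := by
    have hω : 0 ≤ (2 * √2 - 2) * (2 - c ^ 2 * (2 * √2 - 2)) := by
      have h1 := sqrt_two_gt
      have h2 := sqrt_two_lt
      have hp2 : c ^ 2 ≤ 1 := pow_le_one₀ hc hc1.le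
      exact mul_nonneg (by linarith) (by nlinarith)
    have : 0 < s * (s / 2 - ξ * c) * touchDen c b := by
      rw [hRD, ← hs2]
      positivity
    exact pos_of_mul_pos_right (pos_of_mul_pos_left this hD.le) hs.le
  refine ⟨hR, ?_⟩
  rw [← hRD] at hm
  have hm2 : 6 * c * s ^ 2 * b + 2 * c ^ 2 * (s * (s / 2 - ξ * c)) < s ^ 4 := by
    refine lt_of_mul_lt_mul_right ?_ hD.le
    calc _ = 6 * c * (1 - c ^ 2) * b * touchDen c b
          + 2 * c ^ 2 * (s * (s / 2 - ξ * c) * touchDen c b) := by rw [← hs2]; ring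
      _ < _ := hm
      _ = s ^ 4 * touchDen c b := by rw [← hs2]; ring
  have hK : s * (s * ξ * (2 * ξ + c * s))
      = s ^ 2 * (s ^ 2 + s * (s / 2 - ξ * c) + 2 * (b * (2 * √2 - 2)) ^ 2 - 4 * b * c) := by
    linear_combination 2 * s ^ 2 * h.1
  refine lt_of_mul_lt_mul_left ?_ hs.le
  rw [hK]
  have : 0 < s ^ 2 * (s * (s / 2 - ξ * c)) := by positivity
  have : 0 ≤ s ^ 2 * (b * (2 * √2 - 2)) ^ 2 := by positivity
  linarith

/-- A quadratic polynomial with the sign pattern `(≤, ≥, ≤)` at `ω / 2 < ω < 1`. -/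
lemma quadratic_of_alternation {F₀ F₁ F₂ ω : ℝ} (hω : 0 < ω) (hω1 : ω < 1)
    (h1 : F₀ + F₁ * (ω / 2) + F₂ * (ω / 2) ^ 2 ≤ 0) (h2 : 0 ≤ F₀ + F₁ * ω + F₂ * ω ^ 2)
    (h3 : F₀ + F₁ + F₂ ≤ 0) : F₂ ≤ 0 ∧ F₀ ≤ 0 ∧ 0 ≤ F₁ + 3 / 2 * ω * F₂ := by
  -- The two divided differences have opposite signs; subtracting them gives the sign of `F₂`.
  have e1 : 0 ≤ F₁ + 3 / 2 * ω * F₂ := by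
    have : 0 ≤ (ω / 2) * (F₁ + 3 / 2 * ω * F₂) := by linarith
    exact nonneg_of_mul_nonneg_right this (by linarith)
  have e2 : F₁ + (1 + ω) * F₂ ≤ 0 := by
    have : (1 - ω) * (F₁ + (1 + ω) * F₂) ≤ 0 := by linarith
    by_contra! hc
    linarith [mul_pos (sub_pos.2 hω1) hc]
  have e3 : F₂ ≤ 0 := by nlinarith
  exact ⟨e3, by nlinarith [mul_nonneg (neg_nonneg.2 e3) (sq_nonneg ω)], e1⟩

theorem eq_of_radQuad_le {c s ξ b ξ' b' : ℝ} (hs : 0 < s) (hcs : s ^ 2 + c ^ 2 = 1) (hc : 0 ≤ c)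
    (hb : 0 < b) (hb2 : b ≤ 0.128 * (1 - c) ^ 2) (h : IsTouching c s ξ b) (hξ' : 0 < ξ')
    (h1 : radQuad c s ξ' b' ((2 * √2 - 2) / 2) ≤ radQuad c s ξ b ((2 * √2 - 2) / 2))
    (h2 : radQuad c s ξ b (2 * √2 - 2) ≤ radQuad c s ξ' b' (2 * √2 - 2))
    (h3 : radQuad c s ξ' b' 1 ≤ radQuad c s ξ b 1) : ξ' = ξ ∧ b' = b := by
  obtain ⟨hr, hK⟩ := isTouching_margin hs hcs hc hb hb2 h
  have hξ := isTouching_pos hs hcs hc hb hb2 h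
  have hω : 0 < 2 * √2 - 2 := by linarith [sqrt_two_gt]
  have hω1 : 2 * √2 - 2 < 1 := by linarith [sqrt_two_lt]
  unfold radQuad at h1 h2 h3
  generalize 2 * √2 - 2 = ω at *
  obtain ⟨f2, f0, f1⟩ := quadratic_of_alternation
    (F₀ := (ξ' ^ 2 + ξ' * c * s + 2 * b' * c) - (ξ ^ 2 + ξ * c * s + 2 * b * c))
    (F₁ := (2 * ξ' * b' * s - (s / 2 - ξ' * c) ^ 2) - (2 * ξ * b * s - (s / 2 - ξ * c) ^ 2))
    (F₂ := b' ^ 2 - b ^ 2) hω hω1 (by linarith) (by linarith) (by linarith)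
  have hb' : b' ≤ b := le_of_abs_le (abs_le_of_sq_le_sq (by linarith) hb.le)
  have hd : 0 ≤ (2 * ξ' * b' * s - (s / 2 - ξ' * c) ^ 2)
      - (2 * ξ * b * s - (s / 2 - ξ * c) ^ 2) := by
    linarith [mul_nonpos_of_nonneg_of_nonpos hω.le f2]
  have hsb : 0 < s * b := by positivity
  -- The signs give `b' ≤ b`. If `ξ' ≤ ξ`, the linear coefficient can only decrease, so everything
  -- is an equality. If `ξ' > ξ`, the constant coefficient bounds `b - b'` from below and the linear
  -- one bounds it from above, against the margin `hK`.
  rcases le_or_gt ξ' ξ with hle | hlt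
  · have e1 : 0 ≤ s * ξ' * (b - b') := mul_nonneg (by positivity) (by linarith)
    have hpos : 0 < 2 * (s * b) + c * (s - c * ξ - c * ξ') := by
      have : 0 ≤ c * (s - c * ξ - c * ξ') := mul_nonneg hc
        (by linarith [mul_le_mul_of_nonneg_left hle hc])
      linarith
    have e2 : 0 ≤ (ξ - ξ') * (2 * (s * b) + c * (s - c * ξ - c * ξ')) :=
      mul_nonneg (by linarith) hpos.le
    have hsum : 2 * (s * ξ' * (b - b'))
        + (ξ - ξ') * (2 * (s * b) + c * (s - c * ξ - c * ξ')) ≤ 0 := by linarith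
    have e3 : s * ξ' * (b - b') = 0 := by linarith
    have e4 : (ξ - ξ') * (2 * (s * b) + c * (s - c * ξ - c * ξ')) = 0 := by linarith
    have e5 : b - b' = 0 := (mul_eq_zero.1 e3).resolve_left (by positivity)
    have e6 : ξ - ξ' = 0 := (mul_eq_zero.1 e4).resolve_right hpos.ne'
    exact ⟨by linarith, by linarith⟩
  · exfalso
    have hα : 0 < ξ' - ξ := by linarith
    have e1 : (ξ' - ξ) * (2 * ξ + c * s) ≤ 2 * c * (b - b') := by
      linarith [sq_nonneg (ξ' - ξ)]
    have e2 : 2 * s * ξ * (b - b') ≤ (ξ' - ξ) * (2 * s * b + 2 * c * (s / 2 - ξ * c)) := by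
      have t1 : 0 ≤ s * (ξ' - ξ) * (b - b') := by
        have : 0 ≤ b - b' := by linarith
        positivity
      have t2 : 0 ≤ c ^ 2 * (ξ' - ξ) ^ 2 := by positivity
      linarith
    have e3 := mul_le_mul_of_nonneg_left e1 (mul_pos hs hξ).le
    have e4 := mul_le_mul_of_nonneg_left e2 hc
    have e5 := mul_lt_mul_of_pos_left hK hα
    linarith

/-- For `b' ≤ b` the touching quadratics `b'² (w - ω)²` and `b² (w - ω)²` are ordered everywhere and
agree at `ω`, so `eq_of_radQuad_le` applies. -/
lemma touchPoly_zero_unique {c b b' : ℝ} (hc : 0 ≤ c) (hc1 : c < 1) (hb : 0 < b)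
    (hb2 : b ≤ 0.128 * (1 - c) ^ 2) (hb' : 0 < b') (hb2' : b' ≤ 0.128 * (1 - c) ^ 2)
    (h : touchPoly c b = 0) (h' : touchPoly c b' = 0) : b' = b := by
  wlog hle : b' ≤ b generalizing b b'
  · exact (this hb' hb2' hb hb2 h' h (le_of_not_ge hle)).symm
  have hsq : 0 < 1 - c ^ 2 := by nlinarith
  have hs : 0 < √(1 - c ^ 2) := Real.sqrt_pos.2 hsq
  have hcs : √(1 - c ^ 2) ^ 2 + c ^ 2 = 1 := by rw [Real.sq_sqrt hsq.le]; ring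
  have ht := (isTouching_iff hs hcs hc hb).2 ⟨rfl, h⟩
  have ht' := (isTouching_iff hs hcs hc hb').2 ⟨rfl, h'⟩
  have hle2 : b' ^ 2 ≤ b ^ 2 := by gcongr
  refine (eq_of_radQuad_le hs hcs hc hb hb2 ht (isTouching_pos hs hcs hc hb' hb2' ht') ?_ ?_ ?_).2
  · rw [ht.radQuad_eq, ht'.radQuad_eq]
    gcongr
  · rw [ht.radQuad_eq, ht'.radQuad_eq]
    simp
  · rw [ht.radQuad_eq, ht'.radQuad_eq]
    gcongr

/-! ### Quartic `G¹` approximants -/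

lemma bezier_four_apply (b : Fin 5 → Plane) (t : ℝ) (i : Fin 2) :
    bezier b t i = ((1 - t) ^ 4 * b 0 i + 4 * (1 + t) * (1 - t) ^ 3 * b 1 i
      + 6 * (1 + t) ^ 2 * (1 - t) ^ 2 * b 2 i + 4 * (1 + t) ^ 3 * (1 - t) * b 3 i
      + (1 + t) ^ 4 * b 4 i) / 16 := by
  have h2 : Nat.choose 4 2 = 6 := rfl
  simp [bezier, bern, Fin.sum_univ_five, h2]
  ring

lemma bezier_controlPoints_zero (φ ξ η t : ℝ) :
    bezier (controlPoints φ ξ η) t 0 = cos φ + ξ * sin φ * (1 - t ^ 2)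
      + (3 * η - 3 * cos φ - 4 * ξ * sin φ) / 8 * (1 - t ^ 2) ^ 2 := by
  rw [bezier_four_apply]
  simp [controlPoints]
  ring

lemma bezier_controlPoints_one (φ ξ η t : ℝ) :
    bezier (controlPoints φ ξ η) t 1 =
      t * (sin φ + (sin φ / 2 - ξ * cos φ) * (1 - t ^ 2)) := by
  rw [bezier_four_apply]
  simp [controlPoints]
  ring

lemma psi_controlPoints (φ ξ η t : ℝ) :
    psi (bezier (controlPoints φ ξ η)) t = (1 - t ^ 2) ^ 2 *
      radQuad (cos φ) (sin φ) ξ ((3 * η - 3 * cos φ - 4 * ξ * sin φ) / 8) (1 - t ^ 2) := by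
  unfold psi radQuad
  rw [EuclideanSpace.real_norm_sq_eq, Fin.sum_univ_two, bezier_controlPoints_zero,
    bezier_controlPoints_one]
  linear_combination (1 + ξ ^ 2 * (1 - t ^ 2) ^ 2) * Real.sin_sq_add_cos_sq φ

lemma psiUV_eq {φ ξ b u v : ℝ} (hs : sin φ ≠ 0) (hu : u = 3 * cos φ + 8 * b)
    (hv : v = u + 8 * (ξ * sin φ)) (t : ℝ) :
    psiUV φ t u v = (1 - t ^ 2) ^ 2 * radQuad (cos φ) (sin φ) ξ b (1 - t ^ 2) := by
  have h1 : (v - u) / (8 * sin φ) = ξ := by rw [hv]; field_simp; ring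
  unfold psiUV curveUV
  rw [psi_controlPoints, h1]
  congr 2
  rw [hv, hu]; ring

lemma one_sub_sq_sqrt_two_sub_one : 1 - (√2 - 1) ^ 2 = 2 * √2 - 2 := by
  linear_combination -sq_sqrt_two

lemma system_iff_isTouching {φ ξ b u v : ℝ} (hs : sin φ ≠ 0) (hu : u = 3 * cos φ + 8 * b)
    (hv : v = u + 8 * (ξ * sin φ)) :
    System φ u v ↔ IsTouching (cos φ) (sin φ) ξ b := by
  have hω : 0 < 2 * √2 - 2 := by linarith [sqrt_two_gt]
  have ht : 0 < √2 - 1 := by linarith [sqrt_two_gt]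
  unfold System
  simp only [psiUV_eq hs hu hv]
  rw [isTouching_iff_radQuad]
  have hder : deriv (fun t => (1 - t ^ 2) ^ 2 * radQuad (cos φ) (sin φ) ξ b (1 - t ^ 2)) (√2 - 1)
      = -4 * (√2 - 1) * (2 * √2 - 2) * radQuad (cos φ) (sin φ) ξ b (2 * √2 - 2)
        - 2 * (√2 - 1) * (2 * √2 - 2) ^ 2 * (2 * ξ * b * sin φ - (sin φ / 2 - ξ * cos φ) ^ 2
          + 2 * b ^ 2 * (2 * √2 - 2)) := by
    have hw : HasDerivAt (fun t : ℝ => 1 - t ^ 2) (-(2 * (√2 - 1))) (√2 - 1) := by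
      simpa using (hasDerivAt_pow 2 (√2 - 1)).const_sub 1
    have hq : HasDerivAt (fun t => radQuad (cos φ) (sin φ) ξ b (1 - t ^ 2))
        ((2 * ξ * b * sin φ - (sin φ / 2 - ξ * cos φ) ^ 2) * (-(2 * (√2 - 1)))
          + b ^ 2 * (2 * (1 - (√2 - 1) ^ 2) * (-(2 * (√2 - 1))))) (√2 - 1) := by
      unfold radQuad
      have h2 := (hw.fun_pow 2).const_mul (b ^ 2)
      have h1 := hw.const_mul (2 * ξ * b * sin φ - (sin φ / 2 - ξ * cos φ) ^ 2)
      simpa using (h1.const_add (ξ ^ 2 + ξ * cos φ * sin φ + 2 * b * cos φ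
        - 3 * sin φ ^ 2 / 4)).fun_add h2
    have := ((hw.fun_pow 2).fun_mul hq).deriv
    rw [this, one_sub_sq_sqrt_two_sub_one]
    push_cast
    ring
  rw [hder, one_sub_sq_sqrt_two_sub_one]
  have hω2 : (2 * √2 - 2) ^ 2 ≠ 0 := by positivity
  constructor
  · rintro ⟨h0, h1⟩
    have h0' := (mul_eq_zero.1 h0).resolve_left hω2
    refine ⟨h0', ?_⟩
    rw [h0', mul_zero, zero_sub, neg_eq_zero] at h1
    exact (mul_eq_zero.1 h1).resolve_left (by positivity)
  · rintro ⟨h0, h1⟩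
    rw [h0, h1]
    simp

lemma hasDerivAt_bern (n i : ℕ) (t : ℝ) :
    HasDerivAt (bern n i) (n.choose i * (i * ((1 + t) / 2) ^ (i - 1) * (1 / 2))
      * ((1 - t) / 2) ^ (n - i) + n.choose i * ((1 + t) / 2) ^ i
      * ((n - i : ℕ) * ((1 - t) / 2) ^ (n - i - 1) * (-1 / 2))) t := by
  have h1 : HasDerivAt (fun t : ℝ => (1 + t) / 2) (1 / 2) t :=
    ((hasDerivAt_id t).const_add 1).div_const 2
  have h2 : HasDerivAt (fun t : ℝ => (1 - t) / 2) (-1 / 2) t :=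
    ((hasDerivAt_id t).const_sub 1).div_const 2
  exact ((h1.fun_pow i).const_mul (n.choose i : ℝ)).fun_mul (h2.fun_pow (n - i))

lemma hasDerivAt_bezier {n : ℕ} (b : Fin (n + 1) → Plane) (t : ℝ) :
    HasDerivAt (bezier b) (∑ i : Fin (n + 1), deriv (bern n i) t • b i) t := by
  have : bezier b = fun t => ∑ i : Fin (n + 1), bern n i t • b i := rfl
  rw [this]
  refine HasDerivAt.fun_sum fun i _ => ?_
  have h := hasDerivAt_bern n i t
  rw [h.deriv]
  exact h.smul_const (b i)

lemma deriv_bezier_four_one (b : Fin 5 → Plane) :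
    deriv (bezier b) 1 = (2 : ℝ) • (b 4 - b 3) := by
  rw [(hasDerivAt_bezier b 1).deriv]
  simp only [(hasDerivAt_bern _ _ _).deriv]
  ext i
  simp [Fin.sum_univ_five]
  ring

lemma deriv_bezier_four_neg_one (b : Fin 5 → Plane) :
    deriv (bezier b) (-1) = (2 : ℝ) • (b 1 - b 0) := by
  rw [(hasDerivAt_bezier b (-1)).deriv]
  simp only [(hasDerivAt_bern _ _ _).deriv]
  ext i
  simp [Fin.sum_univ_five]
  ring

lemma deriv_arc (α : ℝ) : deriv arc α = !₂[-sin α, cos α] := by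
  have h : arc = fun t => cos t • (!₂[1, 0] : Plane) + sin t • (!₂[0, 1] : Plane) := by
    funext t
    ext i
    fin_cases i <;> simp [arc]
  have h' : HasDerivAt arc ((-sin α) • (!₂[1, 0] : Plane) + cos α • (!₂[0, 1] : Plane)) α := by
    rw [h]
    exact ((Real.hasDerivAt_cos α).smul_const _).fun_add ((Real.hasDerivAt_sin α).smul_const _)
  rw [h'.deriv]
  ext i
  fin_cases i <;> simp

lemma isQuarticG1_controlPoints {φ ξ : ℝ} (hξ : 0 < ξ) (η : ℝ) :
    IsQuarticG1 φ (bezier (controlPoints φ ξ η)) where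
  exists_bezier := ⟨_, rfl⟩
  symm t := by
    ext i
    fin_cases i
    · simp [reflect, bezier_controlPoints_zero]
    · simp [reflect, bezier_controlPoints_one]
  left := by
    ext i
    fin_cases i
    · simp [arc, bezier_controlPoints_zero]
    · simp [arc, bezier_controlPoints_one]
  right := by
    ext i
    fin_cases i
    · simp [arc, bezier_controlPoints_zero]
    · simp [arc, bezier_controlPoints_one]
  tangent_left := by
    refine ⟨2 * ξ, by positivity, ?_⟩
    rw [deriv_bezier_four_neg_one, deriv_arc]
    ext i
    fin_cases i <;> simp [controlPoints] <;> ring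
  tangent_right := by
    refine ⟨2 * ξ, by positivity, ?_⟩
    rw [deriv_bezier_four_one, deriv_arc]
    ext i
    fin_cases i <;> simp [controlPoints] <;> ring

lemma IsQuarticG1.exists_eq {φ : ℝ} (hs : 0 < sin φ) {p : ℝ → Plane} (hp : IsQuarticG1 φ p) :
    ∃ ξ η : ℝ, 0 < ξ ∧ p = bezier (controlPoints φ ξ η) := by
  obtain ⟨b, rfl⟩ := hp.exists_bezier
  obtain ⟨r, hr, hr'⟩ := hp.tangent_left
  obtain ⟨r', hr1, hr1'⟩ := hp.tangent_right
  rw [deriv_bezier_four_neg_one, deriv_arc] at hr'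
  rw [deriv_bezier_four_one, deriv_arc] at hr1'
  have coord : ∀ {x y : Plane}, x = y → ∀ i, x i = y i := fun h i => by rw [h]
  have l0 := coord hp.left 0
  have l1 := coord hp.left 1
  have r0 := coord hp.right 0
  have r1 := coord hp.right 1
  have dl0 := coord hr' 0
  have dl1 := coord hr' 1
  have dr0 := coord hr1' 0
  have dr1 := coord hr1' 1
  -- Symmetry of the abscissa at `1 / 2` equates those of `b 1` and `b 3`, hence `r = r'`; symmetry
  -- of the ordinate at `0` then puts `b 2` on the axis.
  have s0 := coord (hp.symm (1 / 2)) 0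
  have s1 := coord (hp.symm 0) 1
  simp only [bezier_four_apply, arc, reflect, Real.cos_neg, Real.sin_neg] at l0 l1 r0 r1 s0 s1
  simp at l0 l1 r0 r1 s0 s1 dl0 dl1 dr0 dr1
  have hrr : r = r' := by
    have : sin φ * (r - r') = 0 := by linarith
    rcases mul_eq_zero.1 this with h | h <;> linarith
  subst hrr
  refine ⟨r / 2, b 2 0, by linarith, ?_⟩
  congr 1
  funext j
  ext i
  fin_cases j <;> fin_cases i <;> simp [controlPoints] <;> linarith

/-! ### Optimality -/

lemma continuous_psi_controlPoints (φ ξ η : ℝ) :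
    Continuous (psi (bezier (controlPoints φ ξ η))) := by
  have : psi (bezier (controlPoints φ ξ η)) = _ := funext (psi_controlPoints φ ξ η)
  rw [this]
  unfold radQuad
  fun_prop

lemma psi_le_maxError {φ ξ η t : ℝ} (ht : t ∈ Icc (-1 : ℝ) 1) :
    psi (bezier (controlPoints φ ξ η)) t ≤ maxError (bezier (controlPoints φ ξ η)) := by
  refine (le_abs_self _).trans (le_csSup ?_ ⟨t, ht, rfl⟩)
  exact (isCompact_Icc.image (continuous_psi_controlPoints φ ξ η).abs).bddAbove

lemma psi_touching {φ ξ b η t : ℝ} (hη : η = cos φ + (8 * b + 4 * (ξ * sin φ)) / 3)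
    (h : IsTouching (cos φ) (sin φ) ξ b) :
    psi (bezier (controlPoints φ ξ η)) t =
      (b * ((1 - t ^ 2) * (1 - t ^ 2 - (2 * √2 - 2)))) ^ 2 := by
  have : (3 * η - 3 * cos φ - 4 * ξ * sin φ) / 8 = b := by rw [hη]; ring
  rw [psi_controlPoints, this, h.radQuad_eq]
  ring

/-- On `[0, 1]` the minimum of `w (w - ω)` is `-(ω / 2)²` and its maximum is `1 - ω`; both have
modulus `3 - 2√2`. -/
lemma maxError_touching_le {φ ξ b η : ℝ} (hη : η = cos φ + (8 * b + 4 * (ξ * sin φ)) / 3)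
    (h : IsTouching (cos φ) (sin φ) ξ b) :
    maxError (bezier (controlPoints φ ξ η)) ≤ (b * (3 - 2 * √2)) ^ 2 := by
  refine csSup_le ((nonempty_Icc.2 (by norm_num)).image _) ?_
  rintro _ ⟨t, ht, rfl⟩
  simp only
  rw [psi_touching hη h, abs_of_nonneg (sq_nonneg _), mul_pow b, mul_pow b]
  have ht2 : t ^ 2 ≤ 1 := by rw [sq_le_one_iff_abs_le_one]; exact abs_le.2 ht
  have ht0 : 0 ≤ t ^ 2 := sq_nonneg t
  refine mul_le_mul_of_nonneg_left (sq_le_sq' ?_ ?_) (sq_nonneg b)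
  · nlinarith [sq_nonneg (1 - t ^ 2 - (√2 - 1)), sq_sqrt_two]
  · nlinarith [mul_nonneg ht0 (sub_nonneg.2 ht2), sqrt_two_gt, sqrt_two_lt]

theorem eq_of_maxError_le {φ ξ b η : ℝ} (hs : 0 < sin φ) (hc : 0 ≤ cos φ) (hb : 0 < b)
    (hb2 : b ≤ 0.128 * (1 - cos φ) ^ 2) (hη : η = cos φ + (8 * b + 4 * (ξ * sin φ)) / 3)
    (h : IsTouching (cos φ) (sin φ) ξ b) {q : ℝ → Plane} (hq : IsQuarticG1 φ q) (ho : IsOuter q)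
    (hle : maxError q ≤ maxError (bezier (controlPoints φ ξ η))) :
    q = bezier (controlPoints φ ξ η) := by
  obtain ⟨ξ', η', hξ', rfl⟩ := hq.exists_eq hs
  have hle' := hle.trans (maxError_touching_le hη h)
  have h1 := sqrt_two_gt
  have h2 := sqrt_two_lt
  have bound : ∀ t ∈ Icc (-1 : ℝ) 1,
      psi (bezier (controlPoints φ ξ' η')) t ≤ (b * (3 - 2 * √2)) ^ 2 :=
    fun t ht => (psi_le_maxError ht).trans hle'
  have hω : 0 < (2 * √2 - 2) := by linarith
  -- The parameters `√(2 - √2)`, `√2 - 1`, `0` correspond to `w = ω / 2`, `ω`, `1`.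
  have e1 := bound (√(2 - √2)) ⟨by linarith [Real.sqrt_nonneg (2 - √2)],
    Real.sqrt_le_one.2 (by linarith)⟩
  have e2 := ho (√2 - 1) ⟨by linarith, by linarith⟩
  have e3 := bound 0 ⟨by norm_num, by norm_num⟩
  rw [psi_controlPoints, Real.sq_sqrt (by linarith),
    show 1 - (2 - √2) = (2 * √2 - 2) / 2 by ring] at e1
  rw [psi_controlPoints, one_sub_sq_sqrt_two_sub_one] at e2
  rw [psi_controlPoints, show (1 : ℝ) - 0 ^ 2 = 1 by norm_num, one_pow, one_mul] at e3
  obtain ⟨hξξ, hbb⟩ := eq_of_radQuad_le hs (Real.sin_sq_add_cos_sq φ) hc hb hb2 h hξ'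
    (by
      refine le_of_mul_le_mul_left (e1.trans_eq ?_) (show 0 < ((2 * √2 - 2) / 2) ^ 2 by positivity)
      rw [h.radQuad_eq]
      have : (3 - 2 * √2) ^ 2 = (((2 * √2 - 2) / 2) * ((2 * √2 - 2) / 2)) ^ 2 := by
        congr 1
        linear_combination -sq_sqrt_two
      rw [mul_pow, this]
      ring)
    (by
      rw [h.radQuad_eq, sub_self]
      simpa using nonneg_of_mul_nonneg_right e2 (by positivity))
    (e3.trans_eq (by rw [h.radQuad_eq]; ring))
  rw [hξξ] at hbb ⊢
  congr 2
  linarith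

lemma isOptimalOuter_iff {φ ξ b η : ℝ} (hs : 0 < sin φ) (hc : 0 ≤ cos φ) (hb : 0 < b)
    (hb2 : b ≤ 0.128 * (1 - cos φ) ^ 2) (hη : η = cos φ + (8 * b + 4 * (ξ * sin φ)) / 3)
    (h : IsTouching (cos φ) (sin φ) ξ b) (p : ℝ → Plane) :
    IsOptimalOuter φ p ↔ p = bezier (controlPoints φ ξ η) := by
  have hG := isQuarticG1_controlPoints (φ := φ)
    (isTouching_pos hs (Real.sin_sq_add_cos_sq φ) hc hb hb2 h) η
  have hO : IsOuter (bezier (controlPoints φ ξ η)) := fun t _ => by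
    rw [psi_touching hη h]
    positivity
  constructor
  · rintro ⟨hp, ho, hmin⟩
    exact eq_of_maxError_le hs hc hb hb2 hη h hp ho (hmin _ hG hO)
  · rintro rfl
    refine ⟨hG, hO, fun q hq ho => ?_⟩
    by_contra! hlt
    rw [eq_of_maxError_le hs hc hb hb2 hη h hq ho hlt.le] at hlt
    exact lt_irrefl _ hlt

end CircularArc

end

open CircularArc in
theorem mainTheorem1 (φ : ℝ) (hφ_pos : 0 < φ) (hφ_le : φ ≤ Real.pi / 2) :
    ∃ uh vh : ℝ,
      -- the solution lies in the domain `(3c, ũ) × [8 - 5c, ∞)`; for the half circle (`c = 0`)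
      -- one has `uh = ũ`, so the right end point has to be admitted in that case
      (3 * Real.cos φ < uh ∧ uh ≤ uTilde (Real.cos φ) ∧
        (φ < Real.pi / 2 → uh < uTilde (Real.cos φ)) ∧ 8 - 5 * Real.cos φ ≤ vh) ∧
      -- it is the unique solution of the system there
      (∀ u v : ℝ, 3 * Real.cos φ < u → u ≤ uTilde (Real.cos φ) → 8 - 5 * Real.cos φ ≤ v →
        (System φ u v ↔ u = uh ∧ v = vh)) ∧
      -- `uh` is the unique zero of `p₁` in the interval, and `vh = -β₀(uh) / β₁`
      (∀ u : ℝ, 3 * Real.cos φ < u → u ≤ uTilde (Real.cos φ) →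
        (p1 (Real.cos φ) u = 0 ↔ u = uh)) ∧
      beta1 (Real.cos φ) ≠ 0 ∧
      vh = -beta0 (Real.cos φ) uh / beta1 (Real.cos φ) ∧
      -- it induces the optimal outer quartic `G¹` approximant, and no other curve is optimal
      (∀ p : ℝ → Plane, IsOptimalOuter φ p ↔ p = curveUV φ uh vh) := by
  have hs : 0 < Real.sin φ := Real.sin_pos_of_pos_of_lt_pi hφ_pos (by linarith [Real.pi_pos])
  have hcs := Real.sin_sq_add_cos_sq φ
  have hc : 0 ≤ Real.cos φ := Real.cos_nonneg_of_mem_Icc ⟨by linarith [Real.pi_pos], hφ_le⟩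
  have hc1 : Real.cos φ < 1 := by nlinarith
  have hk := kConst_lt
  have range : ∀ b : ℝ, b ≤ kConst * (1 - Real.cos φ) ^ 2 / 8 →
      b ≤ 0.128 * (1 - Real.cos φ) ^ 2 := fun b hb =>
    hb.trans (by nlinarith [sq_nonneg (1 - Real.cos φ)])
  have hU : uTilde (Real.cos φ)
      = 3 * Real.cos φ + 8 * (kConst * (1 - Real.cos φ) ^ 2 / 8) := by
    unfold uTilde; ring
  obtain ⟨b, hb, hbk, hbk', hP⟩ := exists_touchPoly_eq_zero hc hc1
  have hb2 := range b hbk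
  have hD : 0 < touchDen (Real.cos φ) b := by unfold touchDen; positivity
  have unique : ∀ b' : ℝ, 0 < b' → b' ≤ kConst * (1 - Real.cos φ) ^ 2 / 8 →
      touchPoly (Real.cos φ) b' = 0 → b' = b := fun b' h1 h2 h3 =>
    touchPoly_zero_unique hc hc1 hb hb2 h1 (range b' h2) hP h3
  obtain ⟨ξ, hξ⟩ : ∃ ξ, ξ = touchNum (Real.cos φ) b / (Real.sin φ * touchDen (Real.cos φ) b) :=
    ⟨_, rfl⟩
  have hT : IsTouching (Real.cos φ) (Real.sin φ) ξ b := (isTouching_iff hs hcs hc hb).2 ⟨hξ, hP⟩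
  have hξ0 := isTouching_pos hs hcs hc hb hb2 hT
  have hβ := (beta1_neg (Real.cos φ)).ne
  refine ⟨3 * Real.cos φ + 8 * b, 3 * Real.cos φ + 8 * b + 8 * (ξ * Real.sin φ),
    ⟨by linarith, by linarith, fun hlt => ?_, ?_⟩, fun u v hu hu' _ => ?_, fun u hu hu' => ?_,
    hβ, ?_, fun p => ?_⟩
  · have := hbk' (Real.cos_pos_of_mem_Ioo ⟨by linarith, hlt⟩)
    linarith
  -- The midpoint of the curve is `(ξ s + b + c, 0)`. It lies outside the open disc, so `ξ s + b + c
  -- ≥ 1`, and `v = 8 (ξ s + b + c) - 5c`.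
  · have h1 : radQuad (Real.cos φ) (Real.sin φ) ξ b 1
        = (ξ * Real.sin φ + b + Real.cos φ) ^ 2 - 1 := by
      unfold radQuad
      linear_combination (-ξ ^ 2 - 1) * hcs
    rw [hT.radQuad_eq] at h1
    have h2 : 1 ≤ (ξ * Real.sin φ + b + Real.cos φ) ^ 2 := by
      nlinarith [mul_nonneg (sq_nonneg b) (sq_nonneg (1 - (2 * √2 - 2)))]
    have h3 : 0 ≤ ξ * Real.sin φ + b + Real.cos φ := by positivity
    have h4 : 1 ≤ ξ * Real.sin φ + b + Real.cos φ := by nlinarith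
    linarith
  · have hu1 : u = 3 * Real.cos φ + 8 * ((u - 3 * Real.cos φ) / 8) := by ring
    have hv1 : v = u + 8 * ((v - u) / (8 * Real.sin φ) * Real.sin φ) := by field_simp; ring
    rw [system_iff_isTouching hs.ne' hu1 hv1, isTouching_iff hs hcs hc (by linarith)]
    constructor
    · rintro ⟨h1, h2⟩
      have hbb := unique _ (by linarith) (by linarith) h2
      rw [hbb] at h1 hu1
      rw [h1, ← hξ] at hv1
      exact ⟨hu1, by rw [← hu1]; exact hv1⟩
    · rintro ⟨rfl, rfl⟩
      have hbb : (3 * Real.cos φ + 8 * b - 3 * Real.cos φ) / 8 = b := by ring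
      rw [hbb, ← hξ]
      refine ⟨?_, hP⟩
      field_simp
      ring
  · have hu1 : u = 3 * Real.cos φ + 8 * ((u - 3 * Real.cos φ) / 8) := by ring
    have hsq : 1 - Real.cos φ ^ 2 ≠ 0 := by
      rw [show 1 - Real.cos φ ^ 2 = Real.sin φ ^ 2 by linarith]
      positivity
    have hiff : p1 (Real.cos φ) u = 0 ↔ touchPoly (Real.cos φ) ((u - 3 * Real.cos φ) / 8) = 0 := by
      rw [hu1, p1_eq, ← hu1]
      have : 272 + 192 * √2 ≠ 0 := by positivity
      simp [hsq, this]
    rw [hiff]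
    constructor
    · intro h
      rw [unique _ (by linarith) (by linarith) h] at hu1
      exact hu1
    · rintro rfl
      rw [show (3 * Real.cos φ + 8 * b - 3 * Real.cos φ) / 8 = b by ring]
      exact hP
  · have h1 := beta_eq (Real.cos φ) b
    rw [hP, mul_zero] at h1
    rw [eq_div_iff (by positivity)] at hξ
    have h2 : touchDen (Real.cos φ) b * (beta1 (Real.cos φ)
        * (3 * Real.cos φ + 8 * b + 8 * (ξ * Real.sin φ))
        + beta0 (Real.cos φ) (3 * Real.cos φ + 8 * b)) = 0 := by
      linear_combination h1 + 8 * beta1 (Real.cos φ) * hξ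
    have h3 := (mul_eq_zero.1 h2).resolve_left hD.ne'
    rw [eq_div_iff hβ]
    linarith
  · rw [isOptimalOuter_iff hs hc hb hb2 rfl hT]
    have e1 : (3 * Real.cos φ + 8 * b + 8 * (ξ * Real.sin φ) - (3 * Real.cos φ + 8 * b))
        / (8 * Real.sin φ) = ξ := by field_simp; ring
    have e2 : (3 * Real.cos φ + 8 * b + (3 * Real.cos φ + 8 * b + 8 * (ξ * Real.sin φ))) / 6
        = Real.cos φ + (8 * b + 4 * (ξ * Real.sin φ)) / 3 := by ring
    rw [curveUV, e1, e2]
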